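/- Let $K$ be an algebraically closed field of characteristic zero. For a quintic form $f=\sum \alpha_{i,j,k,l}\,x_3^i x_4^j x_1^k x_2^l$ vanishing on $\ell=V(x_3,x_4)\subset\mathbb P^3_K$ put $\partial_j=\partial/\partial x_j$, $\mathfrak d_j=\partial_j\partial_3 f\cdot\partial_4 f-\partial_j\partial_4 f\cdot\partial_3 f$ and, if $\partial_4f|_\ell\neq0$ and $\mathfrak d_2|_\ell\ne 0$, $$A=-\tfrac{\mathfrak d_1}{\mathfrak d_2}\Big|_\ell,\quad B=\tfrac{\partial_3 f\cdot\mathfrak d_4-\partial_4 f\cdot\mathfrak d_3}{2\,\mathfrak d_2\,\partial_4 f}\Big|_\ell,\quad C=-\tfrac{\partial_3 f}{\partial_4 f}\Big|_\ell ,$$ $$\mathfrak b_1(f)=\sum_{\substack{j_1,j_2,j_3\ge 0\\ j_1+j_2\le 4,\ j_3\le 1}} \binom{5-(j_1+j_2+j_3)}{4-(j_1+j_2)}\,\alpha_{j_1,j_2,j_3,5-(j_1+j_2+j_3)}\,A^{1-j_3}B^{4-(j_1+j_2)}C^{j_2}\in K(x_1,x_2).$$ The line $\ell$ is of type $(3^2)$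 if the ramification divisor of the map $\ell\to\mathbb P^1$, $P\mapsto T_PV(f)$ (with values in the pencil of planes containing $\ell$), is $3P_1+3P_2$ for two distinct points $P_1,P_2$. For $a=(\alpha_{2021},\alpha_{1112},\alpha_{1121},\alpha_{0212})\in K^4$, $q=(\alpha_{i,4-i,1,0},\alpha_{i,4-i,0,1})_{0\le i\le 4}\in K^{10}$ and $p=(\alpha_{i,5-i,0,0})_{0\le i\le5}\in K^6$ let $\mathcal N(a,q,p)$ be the quintic form $$x_1^4x_3+x_2^4x_4+\alpha_{2021}x_3^2x_1^2x_2+\alpha_{1112}x_3x_4x_1x_2^2+\alpha_{1121}x_3x_4x_1^2x_2+\alpha_{0212}x_4^2x_1x_2^2$$ $$+\tfrac18\alpha_{2021}^2x_3^3x_2^2+\tfrac18\alpha_{0212}^2x_4^3x_1^2+\tfrac14\alpha_{1121}\alpha_{2021}x_3^2x_4x_2^2+\tfrac18\alpha_{1112}^2x_3^2x_4x_1^2+\tfrac18\alpha_{1121}^2x_3x_4^2x_2^2+\tfrac14\alpha_{0212}\alpha_{1112}x_3x_4^2x_1^2$$ $$+\sum_{i=0}^4(\alpha_{i,4-i,1,0}\,x_1+\alpha_{i,4-i,0,1}\,x_2)\,x_3^ix_4^{4-i}+\sum_{i=0}^5\alpha_{i,5-i,0,0}\,x_3^ix_4^{5-i},$$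 and let $\mathcal Z_5(a,p)=\mathcal N(a,q,p)$ where $q$ is given by $$\begin{aligned} &\alpha_{4001}=\alpha_{0410}=0,\qquad \alpha_{4010}=-\tfrac1{16}\alpha_{2021}^2\alpha_{1112},\qquad \alpha_{0401}=-\tfrac1{16}\alpha_{1121}\alpha_{0212}^2,\\ &\alpha_{3101}=-\tfrac1{16}\alpha_{2021}\alpha_{1112}^2,\qquad \alpha_{1310}=-\tfrac1{16}\alpha_{1121}^2\alpha_{0212},\\ &\alpha_{3110}=-\tfrac18\alpha_{2021}\alpha_{1112}\alpha_{1121}-\tfrac1{16}\alpha_{2021}^2\alpha_{0212},\qquad \alpha_{2201}=-\tfrac18\alpha_{2021}\alpha_{1112}\alpha_{0212}-\tfrac1{16}\alpha_{1112}^2\alpha_{1121},\\ &\alpha_{2210}=-\tfrac18\alpha_{2021}\alpha_{1121}\alpha_{0212}-\tfrac1{16}\alpha_{1112}\alpha_{1121}^2,\qquad \alpha_{1301}=-\tfrac18\alpha_{1112}\alpha_{1121}\alpha_{0212}-\tfrac1{16}\alpha_{2021}\alpha_{0212}^2 . \end{aligned}$$ Then: 1. For all $(a,p)\in K^4\times K^6$,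 $\mathcal Z_5(a,p)$ is a nonzero quintic form vanishing on $\ell$, the line $\ell$ is of type $(3^2)$, and $\mathfrak b_1(\mathcal Z_5(a,p))$ is defined and identically zero. 2. For all $(a,q,p)$, $\mathfrak b_1(\mathcal N(a,q,p))$ is defined, and it is identically zero if and only if $\mathcal N(a,q,p)=\mathcal Z_5(a,p)$. 3. The quintic surface $Z=V(\mathcal Z_5(1,\dots,1))$ is smooth, and on $Z$ the line $\ell$ meets exactly $28$ other lines. 4. Hence the bound $28$ for the number of other lines met by a line on a smooth quintic surface in $\mathbb P^3_K$ cannot be improved: if every line on every smooth quintic surface meets at most $N$ other lines of the surface, then $N\ge 28$. -/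

import Mathlib

open MvPolynomial

/-!
Homogeneous coordinates `x₁, x₂, x₃, x₄` on `ℙ³` are `X 0, X 1, X 2, X 3`; homogeneous coordinates
`x₁, x₂` on the line `ℓ = V(x₃, x₄)` are `X 0, X 1`.
-/

namespace QuinticLines

noncomputable section

/-- `f` defines a smooth surface of degree `d` in `ℙ³` (over an algebraically closed field). -/
def IsSmoothSurface {K : Type*} [Field K] (d : ℕ) (f : MvPolynomial (Fin 4) K) : Prop :=
  f.IsHomogeneous d ∧
    ∀ v : Fin 4 → K, v ≠ 0 → eval v f = 0 → ∃ i, eval v (pderiv i f) ≠ 0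

/-- `L` is a line in `ℙ³` (a two-dimensional subspace of `K⁴`) contained in `V(f)`. -/
def IsLineOn {K : Type*} [Field K] (f : MvPolynomial (Fin 4) K)
    (L : Submodule K (Fin 4 → K)) : Prop :=
  Module.finrank K L = 2 ∧ ∀ v ∈ L, eval v f = 0

/-- The number of lines on `V(f)` that are different from `L` and meet `L` in a point of `ℙ³`. -/
def valency {K : Type*} [Field K] (f : MvPolynomial (Fin 4) K)
    (L : Submodule K (Fin 4 → K)) : ℕ∞ :=
  Set.encard {M : Submodule K (Fin 4 → K) | IsLineOn f M ∧ M ≠ L ∧ M ⊓ L ≠ ⊥}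

/-- The line `ℓ = V(x₃, x₄)`. -/
def lineEll (K : Type*) [Field K] : Submodule K (Fin 4 → K) where
  carrier := {v | v 2 = 0 ∧ v 3 = 0}
  add_mem' := by
    rintro v w ⟨h1, h2⟩ ⟨h3, h4⟩
    simp [h1, h2, h3, h4]
  zero_mem' := by simp
  smul_mem' := by
    rintro c v ⟨h1, h2⟩
    simp [h1, h2]

/-- Restriction of a form to the line `ℓ`. -/
def restrictEll {K : Type*} [Field K] :
    MvPolynomial (Fin 4) K →ₐ[K] MvPolynomial (Fin 2) K :=
  aeval ![X 0, X 1, 0, 0]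

/-- The fibre `F_P` over `P ∈ ℓ` of the pencil of planes through `ℓ` is the curve residual to `ℓ` in
the intersection of `V(f)` with the tangent plane `∂₃f(P) x₃ + ∂₄f(P) x₄ = 0`. This is the
restriction to `ℓ` of the form defining `F_P`. -/
def fibreForm {K : Type*} [Field K] (f : MvPolynomial (Fin 4) K)
    (P : Projectivization K (Fin 2 → K)) : MvPolynomial (Fin 2) K :=
  C (eval P.rep (restrictEll (pderiv 3 f))) * restrictEll (pderiv 2 f) -
    C (eval P.rep (restrictEll (pderiv 2 f))) * restrictEll (pderiv 3 f)

/-- The ramification index at `P` of the map `ℓ → ℙ¹` that sends a point of `ℓ` to the tangent plane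
of `V(f)` there: the order of vanishing at `P` of the fibre through `P`. -/
def ramificationIndex {K : Type*} [Field K] (f : MvPolynomial (Fin 4) K)
    (P : Projectivization K (Fin 2 → K)) : ℕ∞ :=
  emultiplicity (C (P.rep 0) * X 1 - C (P.rep 1) * X 0) (fibreForm f P)

/-- The line `ℓ` on `V(f)` has ramification type `m`: the nonzero multiplicities in the
ramification divisor of `ℓ → ℙ¹` (ramification indices minus one) form the multiset `m`. -/
def HasRamificationType {K : Type*} [Field K] (f : MvPolynomial (Fin 4) K)
    (m : Multiset ℕ) : Prop :=
  ∃ S : Finset (Projectivization K (Fin 2 → K)),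
    (∀ P, P ∈ S ↔ 1 < ramificationIndex f P) ∧
      S.val.map (fun P => ramificationIndex f P - 1) = m.map (fun n : ℕ => (n : ℕ∞))

/-- The coefficient `α_{i,j,k,l}` of the monomial `x₃ⁱ x₄ʲ x₁ᵏ x₂ˡ`. -/
def alpha {K : Type*} [Field K] (f : MvPolynomial (Fin 4) K) (i j k l : ℕ) : K :=
  f.coeff (Finsupp.single 0 k + Finsupp.single 1 l + Finsupp.single 2 i + Finsupp.single 3 j)

/-- The determinant `𝔡_j(f)` with rows `(∂_j∂₃f, ∂_j∂₄f)` and `(∂₃f, ∂₄f)`; the index `j : Fin 4`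
stands for the variable `X j`, so that `𝔡₁, …, 𝔡₄` are `frakD f 0, …, frakD f 3`. -/
def frakD {K : Type*} [Field K] (f : MvPolynomial (Fin 4) K) (j : Fin 4) :
    MvPolynomial (Fin 4) K :=
  pderiv j (pderiv 2 f) * pderiv 3 f - pderiv j (pderiv 3 f) * pderiv 2 f

/-- Restriction to `ℓ`, as an element of the function field `K(x₁, x₂)`. -/
def onEll {K : Type*} [Field K] (g : MvPolynomial (Fin 4) K) :
    FractionRing (MvPolynomial (Fin 2) K) :=
  algebraMap (MvPolynomial (Fin 2) K) _ (restrictEll g)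

def ratA {K : Type*} [Field K] (f : MvPolynomial (Fin 4) K) :
    FractionRing (MvPolynomial (Fin 2) K) :=
  -(onEll (frakD f 0) / onEll (frakD f 1))

def ratB {K : Type*} [Field K] (f : MvPolynomial (Fin 4) K) :
    FractionRing (MvPolynomial (Fin 2) K) :=
  (onEll (pderiv 2 f) * onEll (frakD f 3) - onEll (pderiv 3 f) * onEll (frakD f 2)) /
    (2 * onEll (frakD f 1) * onEll (pderiv 3 f))

def ratC {K : Type*} [Field K] (f : MvPolynomial (Fin 4) K) :
    FractionRing (MvPolynomial (Fin 2) K) :=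
  -(onEll (pderiv 2 f) / onEll (pderiv 3 f))

/-- The denominators in `ratA`, `ratB`, `ratC` do not vanish, so that the rational functions `𝔟_k`
are defined. -/
def FrakBDefined {K : Type*} [Field K] (f : MvPolynomial (Fin 4) K) : Prop :=
  onEll (pderiv 3 f) ≠ 0 ∧ onEll (frakD f 1) ≠ 0

/-- The rational function `𝔟_k(f)` on the line `ℓ`, for a form `f` of degree `d` and
`0 ≤ k ≤ d - 3`. -/
def frakB {K : Type*} [Field K] (d k : ℕ) (f : MvPolynomial (Fin 4) K) :
    FractionRing (MvPolynomial (Fin 2) K) :=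
  ∑ j₁ ∈ Finset.range (k + 4), ∑ j₂ ∈ Finset.range (k + 4), ∑ j₃ ∈ Finset.range (d - (k + 3) + 1),
    if j₁ + j₂ ≤ k + 3 then
      ((d - (j₁ + j₂ + j₃)).choose (k + 3 - (j₁ + j₂)) : FractionRing (MvPolynomial (Fin 2) K)) *
        algebraMap (MvPolynomial (Fin 2) K) _ (C (alpha f j₁ j₂ j₃ (d - (j₁ + j₂ + j₃)))) *
        ratA f ^ (d - (k + 3) - j₃) * ratB f ^ (k + 3 - (j₁ + j₂)) * ratC f ^ j₂
    else 0

/-- The quintics in the normal form for ramification type `(3²)`, with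
`a = (α₂₀₂₁, α₁₁₁₂, α₁₁₂₁, α₀₂₁₂)`, `q i 0 = α_{i,4-i,1,0}`, `q i 1 = α_{i,4-i,0,1}` and
`p i = α_{i,5-i,0,0}`. -/
def normalForm {K : Type*} [Field K] (a : Fin 4 → K) (q : Fin 5 → Fin 2 → K) (p : Fin 6 → K) :
    MvPolynomial (Fin 4) K :=
  X 2 * X 0 ^ 4 + X 3 * X 1 ^ 4
  + C (a 0) * (X 2 ^ 2 * X 0 ^ 2 * X 1) + C (a 1) * (X 2 * X 3 * X 0 * X 1 ^ 2)
  + C (a 2) * (X 2 * X 3 * X 0 ^ 2 * X 1) + C (a 3) * (X 3 ^ 2 * X 0 * X 1 ^ 2)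
  + C (1 / 8 * a 0 ^ 2) * (X 2 ^ 3 * X 1 ^ 2) + C (1 / 8 * a 3 ^ 2) * (X 3 ^ 3 * X 0 ^ 2)
  + C (1 / 4 * (a 2 * a 0)) * (X 2 ^ 2 * X 3 * X 1 ^ 2)
  + C (1 / 8 * a 1 ^ 2) * (X 2 ^ 2 * X 3 * X 0 ^ 2)
  + C (1 / 8 * a 2 ^ 2) * (X 2 * X 3 ^ 2 * X 1 ^ 2)
  + C (1 / 4 * (a 3 * a 1)) * (X 2 * X 3 ^ 2 * X 0 ^ 2)
  + ∑ i : Fin 5, (C (q i 0) * X 0 + C (q i 1) * X 1) * (X 2 ^ (i : ℕ) * X 3 ^ (4 - (i : ℕ)))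
  + ∑ i : Fin 6, C (p i) * (X 2 ^ (i : ℕ) * X 3 ^ (5 - (i : ℕ)))

/-- The coefficients `α_{i,4-i,k,l}` of the members of `𝒵₅`; row `i` is
`(α_{i,4-i,1,0}, α_{i,4-i,0,1})`. -/
def coeffZ {K : Type*} [Field K] (a : Fin 4 → K) : Fin 5 → Fin 2 → K :=
  ![![0, -(1 / 16) * (a 2 * a 3 ^ 2)],
    ![-(1 / 16) * (a 2 ^ 2 * a 3),
      -(1 / 8) * (a 1 * a 2 * a 3) - 1 / 16 * (a 0 * a 3 ^ 2)],
    ![-(1 / 8) * (a 0 * a 2 * a 3) - 1 / 16 * (a 1 * a 2 ^ 2),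
      -(1 / 8) * (a 0 * a 1 * a 3) - 1 / 16 * (a 1 ^ 2 * a 2)],
    ![-(1 / 8) * (a 0 * a 1 * a 2) - 1 / 16 * (a 0 ^ 2 * a 3),
      -(1 / 16) * (a 0 * a 1 ^ 2)],
    ![-(1 / 16) * (a 0 ^ 2 * a 1), 0]]

/-- The family `𝒵₅ : K⁴ × K⁶ → 𝒪(5)`. -/
def familyZ {K : Type*} [Field K] (a : Fin 4 → K) (p : Fin 6 → K) : MvPolynomial (Fin 4) K :=
  normalForm a (coeffZ a) p

end

end QuinticLines

/-! For the normal form, the tangent plane map on ℓ is given by `x₁⁴` and `x₂⁴`, so it ramifies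
exactly at the two coordinate points of ℓ, with index 4. Hence `A = x₂/x₁`, `C = -(x₁/x₂)⁴`, and `B`
depends on `a` only. Therefore `𝔟₁` is a term free of `q` plus `∑ (q i 0 + q i 1 A) C^(4-i)`. The
ten functions `C^j`, `A C^j` are linearly independent, so at most one `q` gives `𝔟₁ = 0`, and an
explicit identity shows that `coeffZ` does (`frakB_coeffZ_identity`,
`eq_zero_of_sum_constEll_eq_zero`).

For the quintic `f` with all parameters 1, restrict to the plane `x₄ = t x₃` with `x₃ = 1`. Then `t
f = t U² + W² + S(t)/256` with quadrics `U`, `W` and a septic `S`. For `t ≠ 0` the quartic `t U² +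
W²` is a product of four lines, through the points `(s : 1 : 0 : 0)` with `s⁴ = -t`. So these lines
lie on the surface exactly when `S(-s⁴) = 0`, an equation of degree 28 in `s` with simple roots.
Conversely, any line meeting ℓ is one of these lines, by comparing coefficients along it. The same
decomposition yields smoothness: a singular point would be a critical point in its plane whose
critical value has a double zero in `t`. -/

namespace QuinticLines

/-! ### First and second partial derivatives of the normal form along ℓ. -/

section Restriction

variable {K : Type*} [Field K] (a : Fin 4 → K) (q : Fin 5 → Fin 2 → K) (p : Fin 6 → K)

lemma restrictEll_pderiv_two_normalForm :
    restrictEll (pderiv 2 (normalForm a q p)) = X 0 ^ 4 := by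
  simp [normalForm, restrictEll, Fin.sum_univ_succ, pderiv_X]

lemma restrictEll_pderiv_three_normalForm :
    restrictEll (pderiv 3 (normalForm a q p)) = X 1 ^ 4 := by
  simp [normalForm, restrictEll, Fin.sum_univ_succ, pderiv_X]

lemma restrictEll_pderiv_zero_two_normalForm :
    restrictEll (pderiv 0 (pderiv 2 (normalForm a q p))) = 4 * X 0 ^ 3 := by
  simp [normalForm, restrictEll, Fin.sum_univ_succ, pderiv_X, map_ofNat]

lemma restrictEll_pderiv_one_two_normalForm :
    restrictEll (pderiv 1 (pderiv 2 (normalForm a q p))) = 0 := by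
  simp [normalForm, restrictEll, Fin.sum_univ_succ, pderiv_X, map_ofNat]

lemma restrictEll_pderiv_zero_three_normalForm :
    restrictEll (pderiv 0 (pderiv 3 (normalForm a q p))) = 0 := by
  simp [normalForm, restrictEll, Fin.sum_univ_succ, pderiv_X, map_ofNat]

lemma restrictEll_pderiv_one_three_normalForm :
    restrictEll (pderiv 1 (pderiv 3 (normalForm a q p))) = 4 * X 1 ^ 3 := by
  simp [normalForm, restrictEll, Fin.sum_univ_succ, pderiv_X, map_ofNat]

lemma restrictEll_pderiv_two_two_normalForm :
    restrictEll (pderiv 2 (pderiv 2 (normalForm a q p))) = 2 * C (a 0) * (X 0 ^ 2 * X 1) := by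
  simp [normalForm, restrictEll, Fin.sum_univ_succ, pderiv_X, map_ofNat]
  ring

lemma restrictEll_pderiv_three_two_normalForm :
    restrictEll (pderiv 3 (pderiv 2 (normalForm a q p))) =
      C (a 1) * (X 0 * X 1 ^ 2) + C (a 2) * (X 0 ^ 2 * X 1) := by
  simp [normalForm, restrictEll, Fin.sum_univ_succ, pderiv_X, map_ofNat]
  ring

lemma restrictEll_pderiv_two_three_normalForm :
    restrictEll (pderiv 2 (pderiv 3 (normalForm a q p))) =
      C (a 1) * (X 0 * X 1 ^ 2) + C (a 2) * (X 0 ^ 2 * X 1) := by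
  simp [normalForm, restrictEll, Fin.sum_univ_succ, pderiv_X, map_ofNat]
  ring

lemma restrictEll_pderiv_three_three_normalForm :
    restrictEll (pderiv 3 (pderiv 3 (normalForm a q p))) = 2 * C (a 3) * (X 0 * X 1 ^ 2) := by
  simp [normalForm, restrictEll, Fin.sum_univ_succ, pderiv_X, map_ofNat]
  ring

end Restriction

/-! ### Monomial expansion of the normal form; the line ℓ lies on the quintic. -/

section Coefficients

variable {K : Type*} [Field K]

/-- The exponent of the monomial `x₃ⁱ x₄ʲ x₁ᵏ x₂ˡ`. -/
noncomputable def expo (i j k l : ℕ) : Fin 4 →₀ ℕ :=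
  Finsupp.single 0 k + Finsupp.single 1 l + Finsupp.single 2 i + Finsupp.single 3 j

lemma expo_eq_iff {i j k l i' j' k' l' : ℕ} :
    expo i j k l = expo i' j' k' l' ↔ i = i' ∧ j = j' ∧ k = k' ∧ l = l' := by
  refine ⟨fun h => ?_, by rintro ⟨rfl, rfl, rfl, rfl⟩; rfl⟩
  have h0 := DFunLike.congr_fun h 0
  have h1 := DFunLike.congr_fun h 1
  have h2 := DFunLike.congr_fun h 2
  have h3 := DFunLike.congr_fun h 3
  simp [expo] at h0 h1 h2 h3
  exact ⟨h2, h3, h0, h1⟩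

lemma monomial_expo (i j k l : ℕ) (c : K) :
    monomial (expo i j k l) c = C c * (X 2 ^ i * X 3 ^ j * X 0 ^ k * X 1 ^ l) := by
  have h (s : Fin 4) (n : ℕ) : (X s ^ n : MvPolynomial (Fin 4) K) =
      monomial (Finsupp.single s n) 1 := by rw [X_pow_eq_monomial]
  rw [h, h, h, h, monomial_mul, monomial_mul, monomial_mul, C_mul_monomial]
  congr 1
  · rw [expo]; ac_rfl
  · simp

lemma alpha_add (f g : MvPolynomial (Fin 4) K) (i j k l : ℕ) :
    alpha (f + g) i j k l = alpha f i j k l + alpha g i j k l := coeff_add ..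

lemma alpha_monomial (i j k l i' j' k' l' : ℕ) (c : K) :
    alpha (monomial (expo i' j' k' l') c) i j k l =
      if i' = i ∧ j' = j ∧ k' = k ∧ l' = l then c else 0 := by
  change coeff (expo i j k l) _ = _
  simp only [coeff_monomial, expo_eq_iff]

lemma normalForm_eq_sum_monomial (a : Fin 4 → K) (q : Fin 5 → Fin 2 → K) (p : Fin 6 → K) :
    normalForm a q p =
      monomial (expo 1 0 4 0) 1 + monomial (expo 0 1 0 4) 1
      + monomial (expo 2 0 2 1) (a 0) + monomial (expo 1 1 1 2) (a 1)
      + monomial (expo 1 1 2 1) (a 2) + monomial (expo 0 2 1 2) (a 3)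
      + monomial (expo 3 0 0 2) (1 / 8 * a 0 ^ 2) + monomial (expo 0 3 2 0) (1 / 8 * a 3 ^ 2)
      + monomial (expo 2 1 0 2) (1 / 4 * (a 2 * a 0)) + monomial (expo 2 1 2 0) (1 / 8 * a 1 ^ 2)
      + monomial (expo 1 2 0 2) (1 / 8 * a 2 ^ 2) + monomial (expo 1 2 2 0) (1 / 4 * (a 3 * a 1))
      + (monomial (expo 0 4 1 0) (q 0 0) + monomial (expo 0 4 0 1) (q 0 1)
      + monomial (expo 1 3 1 0) (q 1 0) + monomial (expo 1 3 0 1) (q 1 1)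
      + monomial (expo 2 2 1 0) (q 2 0) + monomial (expo 2 2 0 1) (q 2 1)
      + monomial (expo 3 1 1 0) (q 3 0) + monomial (expo 3 1 0 1) (q 3 1)
      + monomial (expo 4 0 1 0) (q 4 0) + monomial (expo 4 0 0 1) (q 4 1))
      + (monomial (expo 0 5 0 0) (p 0) + monomial (expo 1 4 0 0) (p 1)
      + monomial (expo 2 3 0 0) (p 2) + monomial (expo 3 2 0 0) (p 3)
      + monomial (expo 4 1 0 0) (p 4) + monomial (expo 5 0 0 0) (p 5)) := by
  simp only [monomial_expo, normalForm, Fin.sum_univ_five, Fin.sum_univ_six, Fin.isValue,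
    Fin.coe_ofNat_eq_mod, Nat.reduceMod, Nat.reduceSub, map_one]
  ring

lemma isHomogeneous_normalForm (a : Fin 4 → K) (q : Fin 5 → Fin 2 → K) (p : Fin 6 → K) :
    (normalForm a q p).IsHomogeneous 5 := by
  have h (i j k l : ℕ) (c : K) (e : i + j + k + l = 5) :
      (monomial (expo i j k l) c).IsHomogeneous 5 := by
    refine isHomogeneous_monomial _ ?_
    simp [expo, Finsupp.degree_eq_sum, Fin.sum_univ_four]
    omega
  rw [normalForm_eq_sum_monomial]
  repeat' refine IsHomogeneous.add ?_ ?_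
  all_goals exact h _ _ _ _ _ rfl

lemma normalForm_ne_zero (a : Fin 4 → K) (q : Fin 5 → Fin 2 → K) (p : Fin 6 → K) :
    normalForm a q p ≠ 0 := by
  intro h
  have := restrictEll_pderiv_two_normalForm a q p
  rw [h] at this
  simp at this
  exact (pow_ne_zero 4 (X_ne_zero (R := K) (0 : Fin 2))) this.symm

lemma eval_normalForm (a : Fin 4 → K) (q : Fin 5 → Fin 2 → K) (p : Fin 6 → K) (v : Fin 4 → K) :
    eval v (normalForm a q p) =
      v 2 * v 0 ^ 4 + v 3 * v 1 ^ 4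
      + a 0 * (v 2 ^ 2 * v 0 ^ 2 * v 1) + a 1 * (v 2 * v 3 * v 0 * v 1 ^ 2)
      + a 2 * (v 2 * v 3 * v 0 ^ 2 * v 1) + a 3 * (v 3 ^ 2 * v 0 * v 1 ^ 2)
      + 1 / 8 * a 0 ^ 2 * (v 2 ^ 3 * v 1 ^ 2) + 1 / 8 * a 3 ^ 2 * (v 3 ^ 3 * v 0 ^ 2)
      + 1 / 4 * (a 2 * a 0) * (v 2 ^ 2 * v 3 * v 1 ^ 2)
      + 1 / 8 * a 1 ^ 2 * (v 2 ^ 2 * v 3 * v 0 ^ 2)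
      + 1 / 8 * a 2 ^ 2 * (v 2 * v 3 ^ 2 * v 1 ^ 2)
      + 1 / 4 * (a 3 * a 1) * (v 2 * v 3 ^ 2 * v 0 ^ 2)
      + ∑ i : Fin 5, (q i 0 * v 0 + q i 1 * v 1) * (v 2 ^ (i : ℕ) * v 3 ^ (4 - (i : ℕ)))
      + ∑ i : Fin 6, p i * (v 2 ^ (i : ℕ) * v 3 ^ (5 - (i : ℕ))) := by
  simp only [normalForm, map_add, map_mul, map_pow, eval_C, eval_X, map_sum]

lemma finrank_lineEll : Module.finrank K (lineEll K) = 2 := by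
  let e : lineEll K ≃ₗ[K] (Fin 2 → K) :=
    { toFun := fun v => ![v.1 0, v.1 1]
      invFun := fun w => ⟨![w 0, w 1, 0, 0], by simp [lineEll]⟩
      map_add' := by intro v w; ext i; fin_cases i <;> simp
      map_smul' := by intro c v; ext i; fin_cases i <;> simp
      left_inv := by
        rintro ⟨v, h2, h3⟩
        ext i; fin_cases i <;> simp [h2, h3]
      right_inv := by intro w; ext i; fin_cases i <;> simp }
  rw [e.finrank_eq]; simp

lemma isLineOn_lineEll (a : Fin 4 → K) (q : Fin 5 → Fin 2 → K) (p : Fin 6 → K) :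
    IsLineOn (normalForm a q p) (lineEll K) := by
  refine ⟨finrank_lineEll, ?_⟩
  rintro v ⟨h2, h3⟩
  rw [eval_normalForm, h2, h3]
  simp [Fin.sum_univ_five, Fin.sum_univ_six]

end Coefficients

/-! ### Ramification type `(3²)`. -/

section Ramification

variable {K : Type*} [Field K] (a : Fin 4 → K) (q : Fin 5 → Fin 2 → K) (p : Fin 6 → K)

lemma fibreForm_normalForm (P : Projectivization K (Fin 2 → K)) :
    fibreForm (normalForm a q p) P = C (P.rep 1 ^ 4) * X 0 ^ 4 - C (P.rep 0 ^ 4) * X 1 ^ 4 := by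
  simp [fibreForm, restrictEll_pderiv_two_normalForm, restrictEll_pderiv_three_normalForm]

lemma emultiplicity_C_mul_X {c d : K} (hc : c ≠ 0) (hd : d ≠ 0) (i : Fin 2) (n : ℕ) :
    emultiplicity (C c * X i) (C d * X i ^ n) = n := by
  have hu (c : K) (hc : c ≠ 0) (f : MvPolynomial (Fin 2) K) : Associated f (C c * f) := by
    have : IsUnit (C c : MvPolynomial (Fin 2) K) := (isUnit_iff_ne_zero.2 hc).map C
    exact (associated_unit_mul_left f _ this).symm
  rw [emultiplicity_eq_of_associated_left (hu c hc (X i)),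
    emultiplicity_eq_of_associated_right (hu d hd (X i ^ n)).symm]
  exact emultiplicity_pow_self_of_prime (X_prime) n

lemma ramificationIndex_of_rep_zero {P : Projectivization K (Fin 2 → K)} (h : P.rep 0 = 0) :
    ramificationIndex (normalForm a q p) P = 4 := by
  have h1 : P.rep 1 ≠ 0 := fun h1 => P.rep_nonzero (by ext i; fin_cases i <;> simp [h, h1])
  rw [ramificationIndex, fibreForm_normalForm, h]
  have := emultiplicity_C_mul_X (neg_ne_zero.2 h1) (pow_ne_zero 4 h1) 0 4
  simpa using this

lemma ramificationIndex_of_rep_one {P : Projectivization K (Fin 2 → K)} (h : P.rep 1 = 0) :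
    ramificationIndex (normalForm a q p) P = 4 := by
  have h1 : P.rep 0 ≠ 0 := fun h1 => P.rep_nonzero (by ext i; fin_cases i <;> simp [h, h1])
  rw [ramificationIndex, fibreForm_normalForm, h]
  have := emultiplicity_C_mul_X h1 (neg_ne_zero.2 (pow_ne_zero 4 h1)) 1 4
  simpa using this

/-- Were the fibre form divisible by the square of the linear form of `P`, its `x₂`-derivative would
vanish at `P`. That value is `-4 p₀⁴ p₁³`, nonzero in characteristic zero. -/
lemma ramificationIndex_le_one [CharZero K] {P : Projectivization K (Fin 2 → K)}
    (h0 : P.rep 0 ≠ 0) (h1 : P.rep 1 ≠ 0) :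
    ¬ 1 < ramificationIndex (normalForm a q p) P := by
  rw [ramificationIndex, fibreForm_normalForm]
  intro h
  have h2 := pow_dvd_of_le_emultiplicity (k := 2) (by
    simpa [one_add_one_eq_two] using Order.add_one_le_of_lt h)
  obtain ⟨g, hg⟩ := h2
  have := congrArg (fun f => eval P.rep (pderiv 1 f)) hg
  simp [pderiv_X] at this
  have hz : P.rep 0 * P.rep 1 - P.rep 1 * P.rep 0 = 0 := by ring
  simp [hz, h0, h1] at this

lemma hasRamificationType_normalForm [CharZero K] :
    HasRamificationType (normalForm a q p) {3, 3} := by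
  classical
  have e0 : (![1, 0] : Fin 2 → K) ≠ 0 := fun h => one_ne_zero (congrFun h 0)
  have e1 : (![0, 1] : Fin 2 → K) ≠ 0 := fun h => one_ne_zero (congrFun h 1)
  obtain ⟨c0, hc0⟩ := Projectivization.exists_smul_eq_mk_rep K _ e0
  obtain ⟨c1, hc1⟩ := Projectivization.exists_smul_eq_mk_rep K _ e1
  set P0 := Projectivization.mk K _ e0
  set P1 := Projectivization.mk K _ e1
  have r0 : P0.rep 1 = 0 := by rw [← hc0]; simp
  have r1 : P1.rep 0 = 0 := by rw [← hc1]; simp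
  have hne : P0 ≠ P1 := by
    intro h
    rw [← h] at r1
    exact P0.rep_nonzero (by ext i; fin_cases i <;> simp [r0, r1])
  refine ⟨{P0, P1}, fun P => ?_, ?_⟩
  · rw [Finset.mem_insert, Finset.mem_singleton]
    constructor
    · rintro (rfl | rfl)
      · rw [ramificationIndex_of_rep_one a q p r0]; norm_num
      · rw [ramificationIndex_of_rep_zero a q p r1]; norm_num
    · intro h
      by_contra! hP
      refine ramificationIndex_le_one a q p (fun h0 => hP.2 ?_) (fun h1 => hP.1 ?_) h
      · rw [← P.mk_rep, Projectivization.mk_eq_mk_iff']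
        exact ⟨P.rep 1, by ext i; fin_cases i <;> simp [h0]⟩
      · rw [← P.mk_rep, Projectivization.mk_eq_mk_iff']
        exact ⟨P.rep 0, by ext i; fin_cases i <;> simp [h1]⟩
  · rw [Finset.insert_val_of_notMem (by simpa using hne)]
    simp [ramificationIndex_of_rep_one a q p r0, ramificationIndex_of_rep_zero a q p r1]
    rfl

end Ramification

/-! ### The function `𝔟₁` on the normal form and its vanishing. -/

section FrakB

variable {K : Type*} [Field K] (a : Fin 4 → K) (q : Fin 5 → Fin 2 → K) (p : Fin 6 → K)

/-- The coordinate functions of `ℓ` as elements of the function field. -/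
noncomputable def coordEll (K : Type*) [Field K] (i : Fin 2) :
    FractionRing (MvPolynomial (Fin 2) K) :=
  algebraMap (MvPolynomial (Fin 2) K) _ (X i)

/-- The constants in the function field of `ℓ`. -/
noncomputable def constEll (K : Type*) [Field K] :
    K →+* FractionRing (MvPolynomial (Fin 2) K) :=
  (algebraMap (MvPolynomial (Fin 2) K) _).comp C

lemma coordEll_ne_zero (i : Fin 2) : coordEll K i ≠ 0 := by
  rw [coordEll, Ne, FaithfulSMul.algebraMap_eq_zero_iff]
  exact X_ne_zero i

lemma onEll_pderiv_two_normalForm : onEll (pderiv 2 (normalForm a q p)) = coordEll K 0 ^ 4 := by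
  rw [onEll, restrictEll_pderiv_two_normalForm, map_pow, coordEll]

lemma onEll_pderiv_three_normalForm :
    onEll (pderiv 3 (normalForm a q p)) = coordEll K 1 ^ 4 := by
  rw [onEll, restrictEll_pderiv_three_normalForm, map_pow, coordEll]

lemma onEll_frakD_zero_normalForm :
    onEll (frakD (normalForm a q p) 0) = 4 * coordEll K 0 ^ 3 * coordEll K 1 ^ 4 := by
  simp [onEll, frakD, restrictEll_pderiv_two_normalForm, restrictEll_pderiv_three_normalForm,
    restrictEll_pderiv_zero_two_normalForm, restrictEll_pderiv_zero_three_normalForm, coordEll,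
    map_ofNat]

lemma onEll_frakD_one_normalForm :
    onEll (frakD (normalForm a q p) 1) = -(4 * coordEll K 1 ^ 3 * coordEll K 0 ^ 4) := by
  simp [onEll, frakD, restrictEll_pderiv_two_normalForm, restrictEll_pderiv_three_normalForm,
    restrictEll_pderiv_one_two_normalForm, restrictEll_pderiv_one_three_normalForm, coordEll,
    map_ofNat]

lemma onEll_frakD_two_normalForm :
    onEll (frakD (normalForm a q p) 2) =
      2 * constEll K (a 0) * (coordEll K 0 ^ 2 * coordEll K 1) * coordEll K 1 ^ 4 -
      (constEll K (a 1) * (coordEll K 0 * coordEll K 1 ^ 2) +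
        constEll K (a 2) * (coordEll K 0 ^ 2 * coordEll K 1)) * coordEll K 0 ^ 4 := by
  simp [onEll, frakD, restrictEll_pderiv_two_normalForm, restrictEll_pderiv_three_normalForm,
    restrictEll_pderiv_two_two_normalForm, restrictEll_pderiv_two_three_normalForm, coordEll,
    constEll, map_ofNat]

lemma onEll_frakD_three_normalForm :
    onEll (frakD (normalForm a q p) 3) =
      (constEll K (a 1) * (coordEll K 0 * coordEll K 1 ^ 2) +
        constEll K (a 2) * (coordEll K 0 ^ 2 * coordEll K 1)) * coordEll K 1 ^ 4 -
      2 * constEll K (a 3) * (coordEll K 0 * coordEll K 1 ^ 2) * coordEll K 0 ^ 4 := by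
  simp [onEll, frakD, restrictEll_pderiv_two_normalForm, restrictEll_pderiv_three_normalForm,
    restrictEll_pderiv_three_two_normalForm, restrictEll_pderiv_three_three_normalForm, coordEll,
    constEll, map_ofNat]

instance charZero_fractionRing [CharZero K] :
    CharZero (FractionRing (MvPolynomial (Fin 2) K)) :=
  charZero_of_injective_algebraMap (R := K) (FaithfulSMul.algebraMap_injective _ _)

lemma frakBDefined_normalForm [CharZero K] : FrakBDefined (normalForm a q p) := by
  rw [FrakBDefined, onEll_pderiv_three_normalForm, onEll_frakD_one_normalForm]
  simp [coordEll_ne_zero]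

lemma ratA_normalForm [CharZero K] :
    ratA (normalForm a q p) = coordEll K 1 / coordEll K 0 := by
  have h0 := coordEll_ne_zero (K := K) 0
  have h1 := coordEll_ne_zero (K := K) 1
  rw [ratA, onEll_frakD_zero_normalForm, onEll_frakD_one_normalForm]
  field_simp

lemma ratC_normalForm :
    ratC (normalForm a q p) = -(coordEll K 0 ^ 4 / coordEll K 1 ^ 4) := by
  rw [ratC, onEll_pderiv_two_normalForm, onEll_pderiv_three_normalForm]

lemma ratB_normalForm [CharZero K] :
    ratB (normalForm a q p) =
      (constEll K (a 0) * coordEll K 1 ^ 7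
        - constEll K (a 1) * coordEll K 0 ^ 3 * coordEll K 1 ^ 4
        - constEll K (a 2) * coordEll K 0 ^ 4 * coordEll K 1 ^ 3
        + constEll K (a 3) * coordEll K 0 ^ 7) / (4 * coordEll K 0 ^ 2 * coordEll K 1 ^ 5) := by
  have h0 := coordEll_ne_zero (K := K) 0
  have h1 := coordEll_ne_zero (K := K) 1
  rw [ratB, onEll_frakD_one_normalForm, onEll_frakD_two_normalForm, onEll_frakD_three_normalForm,
    onEll_pderiv_two_normalForm, onEll_pderiv_three_normalForm]
  field_simp
  ring

/-- Separates the part depending on `a` alone from the part linear in `q`; the parameters `p` do not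
enter, since every monomial in `𝔟₁` contains `x₁` or `x₂`. -/
lemma frakB_normalForm :
    frakB 5 1 (normalForm a q p) =
      (4 * ratA (normalForm a q p) * ratB (normalForm a q p) ^ 3 * ratC (normalForm a q p)
      + constEll K (a 1) * ratB (normalForm a q p) ^ 2 * ratC (normalForm a q p)
      + constEll K (a 3) * ratB (normalForm a q p) ^ 2 * ratC (normalForm a q p) ^ 2
      + 2 * constEll K (1 / 8 * a 0 ^ 2) * ratA (normalForm a q p) * ratB (normalForm a q p)
      + 2 * constEll K (1 / 4 * (a 2 * a 0)) * ratA (normalForm a q p) * ratB (normalForm a q p)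
        * ratC (normalForm a q p)
      + 2 * constEll K (1 / 8 * a 2 ^ 2) * ratA (normalForm a q p) * ratB (normalForm a q p)
        * ratC (normalForm a q p) ^ 2)
      + ∑ i : Fin 5, (constEll K (q i 0) + constEll K (q i 1) * ratA (normalForm a q p))
        * ratC (normalForm a q p) ^ (4 - (i : ℕ)) := by
  rw [frakB]
  simp only [Nat.reduceAdd, Nat.reduceSub, Finset.sum_range_succ, Finset.sum_range_zero]
  -- The rational functions become opaque, so that expanding the normal form affects only the
  -- coefficients `alpha`.
  generalize ratA (normalForm a q p) = A
  generalize ratB (normalForm a q p) = B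
  generalize ratC (normalForm a q p) = D
  simp [normalForm_eq_sum_monomial, alpha_add, alpha_monomial, Fin.sum_univ_five, constEll]
  ring

lemma frakB_coeffZ_identity {L : Type*} [Field L] [CharZero L] {u v : L} (hu : u ≠ 0)
    (hv : v ≠ 0) (a₀ a₁ a₂ a₃ A B D : L) (hA : A = v / u) (hD : D = -(u ^ 4 / v ^ 4))
    (hB : B = (a₀ * v ^ 7 - a₁ * u ^ 3 * v ^ 4 - a₂ * u ^ 4 * v ^ 3 + a₃ * u ^ 7) /
      (4 * u ^ 2 * v ^ 5)) :
    (4 * A * B ^ 3 * D + a₁ * B ^ 2 * D + a₃ * B ^ 2 * D ^ 2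
      + 2 * (1 / 8 * a₀ ^ 2) * A * B + 2 * (1 / 4 * (a₂ * a₀)) * A * B * D
      + 2 * (1 / 8 * a₂ ^ 2) * A * B * D ^ 2)
      + ((0 + -(1 / 16) * (a₂ * a₃ ^ 2) * A) * D ^ 4
      + (-(1 / 16) * (a₂ ^ 2 * a₃)
        + (-(1 / 8) * (a₁ * a₂ * a₃) - 1 / 16 * (a₀ * a₃ ^ 2)) * A) * D ^ 3
      + (-(1 / 8) * (a₀ * a₂ * a₃) - 1 / 16 * (a₁ * a₂ ^ 2)
        + (-(1 / 8) * (a₀ * a₁ * a₃) - 1 / 16 * (a₁ ^ 2 * a₂)) * A) * D ^ 2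
      + (-(1 / 8) * (a₀ * a₁ * a₂) - 1 / 16 * (a₀ ^ 2 * a₃)
        + -(1 / 16) * (a₀ * a₁ ^ 2) * A) * D
      + (-(1 / 16) * (a₀ ^ 2 * a₁) + 0 * A)) = 0 := by
  rw [hA, hB, hD]
  field_simp
  ring

lemma frakB_familyZ [CharZero K] : frakB 5 1 (familyZ a p) = 0 := by
  have h := frakB_coeffZ_identity (coordEll_ne_zero (K := K) 0) (coordEll_ne_zero (K := K) 1)
    (constEll K (a 0)) (constEll K (a 1)) (constEll K (a 2)) (constEll K (a 3)) _ _ _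
    (ratA_normalForm a (coeffZ a) p) (ratC_normalForm a (coeffZ a) p)
    (ratB_normalForm a (coeffZ a) p)
  rw [familyZ, frakB_normalForm]
  simpa [Fin.sum_univ_five, coeffZ, map_ofNat] using h

/-- Multiplying by `x₁ x₂¹⁶` turns the ten functions into distinct monomials of degree 17, up to
sign. -/
lemma eq_zero_of_sum_constEll_eq_zero (r : Fin 5 → Fin 2 → K)
    (h : ∑ i : Fin 5, (constEll K (r i 0) + constEll K (r i 1) * (coordEll K 1 / coordEll K 0))
        * (-(coordEll K 0 ^ 4 / coordEll K 1 ^ 4)) ^ (4 - (i : ℕ)) = 0) : r = 0 := by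
  have h0 := coordEll_ne_zero (K := K) 0
  have h1 := coordEll_ne_zero (K := K) 1
  have h2 : algebraMap (MvPolynomial (Fin 2) K) (FractionRing (MvPolynomial (Fin 2) K))
      (C (r 0 0) * X 0 ^ 17 + C (r 0 1) * X 0 ^ 16 * X 1
        - C (r 1 0) * X 0 ^ 13 * X 1 ^ 4 - C (r 1 1) * X 0 ^ 12 * X 1 ^ 5
        + C (r 2 0) * X 0 ^ 9 * X 1 ^ 8 + C (r 2 1) * X 0 ^ 8 * X 1 ^ 9
        - C (r 3 0) * X 0 ^ 5 * X 1 ^ 12 - C (r 3 1) * X 0 ^ 4 * X 1 ^ 13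
        + C (r 4 0) * X 0 * X 1 ^ 16 + C (r 4 1) * X 1 ^ 17) = 0 := by
    rw [← mul_zero (coordEll K 0 * coordEll K 1 ^ 16), ← h]
    have hc (c : K) : algebraMap (MvPolynomial (Fin 2) K)
      (FractionRing (MvPolynomial (Fin 2) K)) (C c) = constEll K c := rfl
    have hx (i : Fin 2) : algebraMap (MvPolynomial (Fin 2) K)
      (FractionRing (MvPolynomial (Fin 2) K)) (X i) = coordEll K i := rfl
    simp only [map_add, map_sub, map_mul, map_pow, hc, hx, Fin.sum_univ_five, Fin.isValue,
      Fin.coe_ofNat_eq_mod, Nat.reduceMod, Nat.reduceSub]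
    field_simp
    ring
  rw [FaithfulSMul.algebraMap_eq_zero_iff] at h2
  -- Setting `x₂ = 1` keeps the monomials apart: the exponents of `x₁` are 17, 16, 13, 12, 9, 8, 5,
  -- 4, 1, 0.
  have h3 := congrArg (aeval ![(Polynomial.X : Polynomial K), 1]) h2
  simp at h3
  have h4 (n : ℕ) := congrArg (fun f => Polynomial.coeff f n) h3
  simp [Polynomial.coeff_X_pow, Polynomial.coeff_X] at h4
  ext i j
  fin_cases i <;> fin_cases j
  · simpa using h4 17
  · simpa using h4 16
  · simpa using h4 13
  · simpa using h4 12
  · simpa using h4 9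
  · simpa using h4 8
  · simpa using h4 5
  · simpa using h4 4
  · simpa using h4 1
  · simpa using h4 0

lemma frakB_normalForm_eq_zero_iff [CharZero K] :
    frakB 5 1 (normalForm a q p) = 0 ↔ normalForm a q p = familyZ a p := by
  refine ⟨fun h => ?_, fun h => by rw [h, frakB_familyZ]⟩
  have h' := frakB_familyZ a p
  rw [familyZ, frakB_normalForm, ratA_normalForm, ratB_normalForm, ratC_normalForm] at h'
  rw [frakB_normalForm, ratA_normalForm, ratB_normalForm, ratC_normalForm] at h
  -- In the difference of the two vanishing values of `𝔟₁` the part depending on `a` cancels.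
  have hr := eq_zero_of_sum_constEll_eq_zero (fun i j => q i j - coeffZ a i j) (by
    rw [← sub_eq_zero.2 (h.trans h'.symm), add_sub_add_left_eq_sub, ← Finset.sum_sub_distrib]
    refine Finset.sum_congr rfl fun i _ => ?_
    rw [map_sub, map_sub]
    ring)
  have hq : q = coeffZ a := by
    ext i j
    exact sub_eq_zero.1 (congrFun (congrFun hr i) j)
  rw [hq, familyZ]

end FrakB

/-! ### Smoothness of the quintic with all parameters 1. -/

section Smoothness

variable {K : Type*} [Field K]

/-- The quintic of the family `𝒵₅` all of whose parameters are `1`. -/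
noncomputable def quinticOne (K : Type*) [Field K] : MvPolynomial (Fin 4) K :=
  familyZ (fun _ => (1 : K)) (fun _ => 1)

lemma eval_quinticOne [CharZero K] (v : Fin 4 → K) :
    eval v (quinticOne K) =
      v 2 * v 0 ^ 4 + v 3 * v 1 ^ 4 + v 2 ^ 2 * v 0 ^ 2 * v 1 + v 2 * v 3 * v 0 * v 1 ^ 2
      + v 2 * v 3 * v 0 ^ 2 * v 1 + v 3 ^ 2 * v 0 * v 1 ^ 2
      + (v 2 ^ 3 * v 1 ^ 2 + v 3 ^ 3 * v 0 ^ 2 + 2 * v 2 ^ 2 * v 3 * v 1 ^ 2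
        + v 2 ^ 2 * v 3 * v 0 ^ 2 + v 2 * v 3 ^ 2 * v 1 ^ 2 + 2 * v 2 * v 3 ^ 2 * v 0 ^ 2) / 8
      - (v 1 * v 3 ^ 4 + (v 0 + 3 * v 1) * v 2 * v 3 ^ 3 + 3 * (v 0 + v 1) * v 2 ^ 2 * v 3 ^ 2
        + (3 * v 0 + v 1) * v 2 ^ 3 * v 3 + v 0 * v 2 ^ 4) / 16
      + (v 3 ^ 5 + v 2 * v 3 ^ 4 + v 2 ^ 2 * v 3 ^ 3 + v 2 ^ 3 * v 3 ^ 2 + v 2 ^ 4 * v 3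
        + v 2 ^ 5) := by
  rw [quinticOne, familyZ, eval_normalForm]
  simp [Fin.sum_univ_five, Fin.sum_univ_six, coeffZ]
  ring

lemma eval_pderiv_zero_quinticOne [CharZero K] (v : Fin 4 → K) :
    eval v (pderiv 0 (quinticOne K)) =
      4 * v 2 * v 0 ^ 3 + 2 * v 2 ^ 2 * v 0 * v 1 + v 2 * v 3 * v 1 ^ 2
      + 2 * v 2 * v 3 * v 0 * v 1 + v 3 ^ 2 * v 1 ^ 2
      + (v 3 ^ 3 * v 0 + v 2 ^ 2 * v 3 * v 0 + 2 * v 2 * v 3 ^ 2 * v 0) / 4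
      - (v 2 * v 3 ^ 3 + 3 * v 2 ^ 2 * v 3 ^ 2 + 3 * v 2 ^ 3 * v 3 + v 2 ^ 4) / 16 := by
  simp [quinticOne, familyZ, normalForm, Fin.sum_univ_five, Fin.sum_univ_six, coeffZ, pderiv_X]
  ring

lemma eval_pderiv_one_quinticOne [CharZero K] (v : Fin 4 → K) :
    eval v (pderiv 1 (quinticOne K)) =
      4 * v 3 * v 1 ^ 3 + v 2 ^ 2 * v 0 ^ 2 + 2 * v 2 * v 3 * v 0 * v 1
      + v 2 * v 3 * v 0 ^ 2 + 2 * v 3 ^ 2 * v 0 * v 1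
      + (v 2 ^ 3 * v 1 + 2 * v 2 ^ 2 * v 3 * v 1 + v 2 * v 3 ^ 2 * v 1) / 4
      - (v 3 ^ 4 + 3 * v 2 * v 3 ^ 3 + 3 * v 2 ^ 2 * v 3 ^ 2 + v 2 ^ 3 * v 3) / 16 := by
  simp [quinticOne, familyZ, normalForm, Fin.sum_univ_five, Fin.sum_univ_six, coeffZ, pderiv_X]
  ring

lemma eval_pderiv_three_quinticOne [CharZero K] (v : Fin 4 → K) :
    eval v (pderiv 3 (quinticOne K)) =
      v 1 ^ 4 + v 2 * v 0 * v 1 ^ 2 + v 2 * v 0 ^ 2 * v 1 + 2 * v 3 * v 0 * v 1 ^ 2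
      + (3 * v 3 ^ 2 * v 0 ^ 2 + 2 * v 2 ^ 2 * v 1 ^ 2
        + v 2 ^ 2 * v 0 ^ 2 + 2 * v 2 * v 3 * v 1 ^ 2 + 4 * v 2 * v 3 * v 0 ^ 2) / 8
      - (4 * v 1 * v 3 ^ 3 + 3 * (v 0 + 3 * v 1) * v 2 * v 3 ^ 2 + 6 * (v 0 + v 1) * v 2 ^ 2 * v 3
        + (3 * v 0 + v 1) * v 2 ^ 3) / 16
      + (5 * v 3 ^ 4 + 4 * v 2 * v 3 ^ 3 + 3 * v 2 ^ 2 * v 3 ^ 2 + 2 * v 2 ^ 3 * v 3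
        + v 2 ^ 4) := by
  simp [quinticOne, familyZ, normalForm, Fin.sum_univ_five, Fin.sum_univ_six, coeffZ, pderiv_X]
  ring

lemma eval_pderiv_two_quinticOne_of_mem [CharZero K] (v : Fin 4 → K) (h2 : v 2 = 0)
    (h3 : v 3 = 0) : eval v (pderiv 2 (quinticOne K)) = v 0 ^ 4 := by
  simp [quinticOne, familyZ, normalForm, Fin.sum_univ_five, Fin.sum_univ_six, coeffZ, pderiv_X,
    h2, h3]

/-- The septic `-1 + 252 t + ⋯ - t⁷`, whose zeros give the planes `x₄ = t x₃` that meet the surface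
in five lines, has no double zero. -/
lemma septic_squarefree [CharZero K] {t : K}
    (h : -1 + 252 * t + 250 * t ^ 2 + 251 * t ^ 3 + 251 * t ^ 4 + 250 * t ^ 5 + 252 * t ^ 6
      - t ^ 7 = 0)
    (h' : 252 + 500 * t + 753 * t ^ 2 + 1004 * t ^ 3 + 1250 * t ^ 4 + 1512 * t ^ 5
      - 7 * t ^ 6 = 0) : False := by
  -- A Bézout relation between the septic and its derivative, with denominators cleared; the
  -- constant is nonzero in characteristic zero.
  have : (196387707027456 : K) = 0 := by
    linear_combination
      (-2556316001484 - 2695186498072 * t - 3580260927525 * t ^ 2 - 4457949201783 * t ^ 3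
        - 5365985295139 * t ^ 4 + 24842989563 * t ^ 5) * h
      + (769172186611 + 1019485526073 * t + 895858402393 * t ^ 2 + 894242332294 * t ^ 3
        + 890866381881 * t ^ 4 + 894333274201 * t ^ 5 - 3548998509 * t ^ 6) * h'
  norm_num at this

/-- A Bézout relation between a quartic in `t` and its derivative, with coefficients in `ℤ[w]/(w³ -
1)`, so that all cube roots of unity, including 1, are treated at once. -/
lemma quartic_squarefree [CharZero K] {t w : K} (hw : w ^ 3 = 1)
    (h : 256 * (1 + t ^ 2 + t ^ 4) + 3 * w * (1 + t) ^ 3 * (1 + t * w) = 0)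
    (h' : 512 * t + 1024 * t ^ 3 + 9 * w * (1 + t) ^ 2 * (1 + t * w)
      + 3 * w ^ 2 * (1 + t) ^ 3 = 0) : False := by
  have : (3552687629199740928 : K) = 0 := by
    linear_combination
      (13877771156001060 - 162301060592844 * w - 2207687825100 * w ^ 2 - 15346710989936 * t -
        636206448825520 * t * w - 54614718175408 * t * w ^ 2 - 9271756658533348 * t ^ 2 -
        293801129169124 * t ^ 2 * w - 492376976863972 * t ^ 2 * w ^ 2) * h
      + (4040293786351 + 115550042627231 * w - 40201533437425 * w ^ 2 - 2306878367905189 * t +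
        118730827216235 * t * w + 90919830497483 * t * w ^ 2 + 4753431910373 * t ^ 2 +
        166683196413061 * t ^ 2 * w + 34230634894069 * t ^ 2 * w ^ 2 + 2317939164633337 * t ^ 3
        + 73450282292281 * t ^ 3 * w + 123094244215993 * t ^ 3 * w ^ 2) * h'
      - (-120604600312275 * w - 457491173856501 * t * w + 470094105874302 * t ^ 2 * w +
        969318598327674 * t ^ 3 * w - 698586814832187 * t ^ 4 * w - 860924733741333 * t ^ 5 * w
        - 21786736530432 + 1860127594811904 * t + 1982013015722496 * t ^ 2 - 2642259961910784 *
        t ^ 3 - 3681114909089280 * t ^ 4 - 938756262798336 * t ^ 5) * hw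
  norm_num at this

/-- The chart `x₃ = 1`, with `x, y, t` for `x₁, x₂, x₄`. -/
lemma no_singular_point_of_one [CharZero K] {x y t : K}
    (hF : x ^ 4 + t * y ^ 4 + x ^ 2 * y + t * x * y ^ 2 + t * x ^ 2 * y + t ^ 2 * x * y ^ 2
      + (y ^ 2 + t ^ 3 * x ^ 2 + 2 * t * y ^ 2 + t * x ^ 2 + t ^ 2 * y ^ 2 + 2 * t ^ 2 * x ^ 2) / 8
      - (y * t ^ 4 + (x + 3 * y) * t ^ 3 + 3 * (x + y) * t ^ 2 + (3 * x + y) * t + x) / 16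
      + (t ^ 5 + t ^ 4 + t ^ 3 + t ^ 2 + t + 1) = 0)
    (hx : 4 * x ^ 3 + 2 * x * y + t * y ^ 2 + 2 * t * x * y + t ^ 2 * y ^ 2
      + (t ^ 3 * x + t * x + 2 * t ^ 2 * x) / 4 - (t ^ 3 + 3 * t ^ 2 + 3 * t + 1) / 16 = 0)
    (hy : 4 * t * y ^ 3 + x ^ 2 + 2 * t * x * y + t * x ^ 2 + 2 * t ^ 2 * x * y
      + (y + 2 * t * y + t ^ 2 * y) / 4 - (t ^ 4 + 3 * t ^ 3 + 3 * t ^ 2 + t) / 16 = 0)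
    (ht : y ^ 4 + x * y ^ 2 + x ^ 2 * y + 2 * t * x * y ^ 2
      + (3 * t ^ 2 * x ^ 2 + 2 * y ^ 2 + x ^ 2 + 2 * t * y ^ 2 + 4 * t * x ^ 2) / 8
      - (4 * y * t ^ 3 + 3 * (x + 3 * y) * t ^ 2 + 6 * (x + y) * t + (3 * x + y)) / 16
      + (5 * t ^ 4 + 4 * t ^ 3 + 3 * t ^ 2 + 2 * t + 1) = 0) : False := by
  -- The decomposition is one of `t f`, so the plane `t = 0` is excluded by hand.
  rcases eq_or_ne t 0 with rfl | ht0
  · have h1 : y = -4 * x ^ 2 := by linear_combination 4 * hy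
    subst h1
    have h2 : x ^ 3 = -1 / 64 := by linear_combination (-1 / 4) * hx
    have h3 : x = 64 / 3 := by linear_combination (-64 / 3) * hF - 64 / 3 * x * h2
    rw [h3] at h2
    norm_num at h2
  obtain ⟨b, hb⟩ : ∃ b, b = (1 + t) / 4 := ⟨_, rfl⟩
  obtain ⟨U, hU⟩ : ∃ U, U = x ^ 2 + 2 * b * y - t * b ^ 2 := ⟨_, rfl⟩
  obtain ⟨W, hW⟩ : ∃ W, W = t * y ^ 2 + 2 * t * b * x - b ^ 2 := ⟨_, rfl⟩
  have hx' : x * U + b * W = 0 := by rw [hU, hW, hb]; linear_combination hx / 4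
  have hy' : b * U + y * W = 0 := by rw [hU, hW, hb]; linear_combination hy / 4
  -- `t f = t U ^ 2 + W ^ 2` up to the septic in `t`, and likewise for the `t`-derivatives
  have hFU : 256 * (t * U ^ 2 + W ^ 2) + (-1 + 252 * t + 250 * t ^ 2 + 251 * t ^ 3 + 251 * t ^ 4
      + 250 * t ^ 5 + 252 * t ^ 6 - t ^ 7) = 0 := by
    rw [hU, hW, hb]; linear_combination 256 * t * hF
  have htU : 256 * (U ^ 2 + 2 * t * U * (y / 2 - b ^ 2 - t * b / 2)
      + 2 * W * (y ^ 2 + 2 * b * x + t * x / 2 - b / 2)) + (252 + 500 * t + 753 * t ^ 2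
      + 1004 * t ^ 3 + 1250 * t ^ 4 + 1512 * t ^ 5 - 7 * t ^ 6) = 0 := by
    rw [hU, hW, hb]; linear_combination 256 * hF + 256 * t * ht
  by_cases hUW : U = 0 ∧ W = 0
  · obtain ⟨h1, h2⟩ := hUW
    rw [h1, h2] at hFU htU
    exact septic_squarefree (by linear_combination hFU) (by linear_combination htU)
  -- `hx'` and `hy'` form a linear system for `(U, W)` with determinant `x y - b²`, and `(U, W) ≠
  -- 0`.
  have hxy : x * y = b ^ 2 := by
    by_contra hne
    have hne' := sub_ne_zero.2 hne
    refine hUW ⟨(mul_eq_zero_iff_left hne').1 ?_, (mul_eq_zero_iff_left hne').1 ?_⟩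
    · linear_combination y * hx' - b * hy'
    · linear_combination x * hy' - b * hx'
  rcases eq_or_ne b 0 with hb0 | hb0
  · rw [hb0] at hU hW hx' hy' hxy
    have hx0 : x = 0 := by
      refine pow_eq_zero_iff (n := 3) three_ne_zero |>.1 ?_
      rw [hU] at hx'; linear_combination hx'
    have hy0 : y = 0 := by
      have : t * y ^ 3 = 0 := by rw [hW] at hy'; linear_combination hy'
      simpa [ht0] using this
    exact (hUW ⟨by rw [hU, hx0]; ring, by rw [hW, hy0]; ring⟩).elim
  have hx0 : x ≠ 0 := by
    rintro rfl
    exact hb0 (by simpa using hxy.symm)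
  -- Multiplying `x U + b W` by `x²` and eliminating `y` through `x y = b²` gives this product.
  have hprod : (x ^ 3 + b ^ 3) * (x ^ 2 + t * b ^ 2) = 0 := by
    rw [hU, hW] at hx'
    linear_combination x ^ 2 * hx' - (2 * b * x ^ 2 + b * t * (x * y + b ^ 2)) * hxy
  rcases mul_eq_zero.1 hprod with h | h
  · -- the critical points outside the four lines
    obtain ⟨w, rfl⟩ : ∃ w, x = -w * b := ⟨-x / b, by field_simp⟩
    have hw : w ^ 3 = 1 := by
      refine mul_left_cancel₀ (pow_ne_zero 3 hb0) ?_
      linear_combination -h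
    obtain rfl : y = -w ^ 2 * b := by
      have : b * (w * y + b) = 0 := by linear_combination -hxy
      have := (mul_eq_zero_iff_left hb0).1 this
      linear_combination w ^ 2 * this - y * hw
    -- The left side is `256 f` at `(-w b, -w² b)`. As the `x`- and `y`-derivatives of `f` vanish
    -- there for every `t`, the condition `∂f/∂t = 0` says that the `t`-derivative of this critical
    -- value vanishes too.
    have h1 : (1 + t) * (256 * (1 + t ^ 2 + t ^ 4) + 3 * w * (1 + t) ^ 3 * (1 + t * w)) = 0 := by
      rw [hb] at hF
      linear_combination 256 * hF - 256 * (((1 + t) / 4) ^ 4 * w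
        + t * ((1 + t) / 4) ^ 4 * (w ^ 5 + w ^ 2) - ((1 + t) / 4) ^ 3 * w
        - t * ((1 + t) / 4) ^ 3 * w ^ 2 - t * ((1 + t) / 4) ^ 3 * w
        - t ^ 2 * ((1 + t) / 4) ^ 3 * w ^ 2 + 2 * ((1 + t) / 4) ^ 4 * w) * hw
    have ht1 : 1 + t ≠ 0 := fun h0 => hb0 (by rw [hb, h0, zero_div])
    have h2 := (mul_eq_zero_iff_left ht1).1 h1
    refine quartic_squarefree hw h2 ((mul_eq_zero_iff_left ht1).1 ?_)
    rw [hb] at ht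
    linear_combination 256 * ht - h2 - 256 * (((1 + t) / 4) ^ 4 * (w ^ 5 + w ^ 2)
      - ((1 + t) / 4) ^ 3 * w ^ 2 - 2 * t * ((1 + t) / 4) ^ 3 * w ^ 2) * hw
  · -- two more double points of the union of the four lines
    obtain rfl : x = -t * y := by
      refine mul_left_cancel₀ hx0 ?_
      linear_combination h + t * hxy
    have hR : t * y ^ 2 + b ^ 2 = 0 := by linear_combination -hxy
    -- With these values `t U² + W² = 4 b² (1 + t³)(t y² + b²) = 0`, so the septic vanishes again,
    -- and likewise its derivative.
    have hU' : U = 2 * b * (y - t * b) := by rw [hU]; linear_combination t * hR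
    have hW' : W = -2 * b * (t ^ 2 * y + b) := by rw [hW]; linear_combination hR
    refine septic_squarefree (t := t) ?_ ?_
    · rw [hU', hW'] at hFU
      linear_combination hFU - 1024 * b ^ 2 * (1 + t ^ 3) * hR
    · refine (mul_eq_zero_iff_left ht0).1 ?_
      rw [hU', hW', hb] at htU
      rw [hb] at hR
      linear_combination t * htU - 256 * (4 * ((1 + t) / 4) ^ 2 + 2 * ((1 + t) / 4) * t
        + 8 * ((1 + t) / 4) ^ 2 * t ^ 3 + 2 * ((1 + t) / 4) * t ^ 4
        - 4 * ((1 + t) / 4) * (t ^ 2 * y + (1 + t) / 4)) * hR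

/-- The remaining plane `x₃ = 0`, normalised by `x₄ = 1`. -/
lemma no_singular_point_of_zero [CharZero K] {x y : K}
    (hF : y ^ 4 + x * y ^ 2 + x ^ 2 / 8 - y / 16 + 1 = 0) (hx : y ^ 2 + x / 4 = 0)
    (hy : 4 * y ^ 3 + 2 * x * y - 1 / 16 = 0) : False := by
  obtain rfl : x = -4 * y ^ 2 := by linear_combination 4 * hx
  have h2 : y ^ 3 = -1 / 64 := by linear_combination (-1 / 4) * hy
  have h3 : y = 64 / 3 := by linear_combination (-64 / 3) * hF - 64 / 3 * y * h2
  rw [h3] at h2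
  norm_num at h2

lemma isSmoothSurface_quinticOne [CharZero K] : IsSmoothSurface 5 (quinticOne K) := by
  refine ⟨by rw [quinticOne, familyZ]; exact isHomogeneous_normalForm _ _ _, fun v hv hF => ?_⟩
  by_contra! h
  have hx := h 0
  have hy := h 1
  -- Used only at points of ℓ; elsewhere `f` and the other partial derivatives suffice.
  have hz := h 2
  have ht := h 3
  rw [eval_quinticOne] at hF
  rw [eval_pderiv_zero_quinticOne] at hx
  rw [eval_pderiv_one_quinticOne] at hy
  rw [eval_pderiv_three_quinticOne] at ht
  by_cases h2 : v 2 = 0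
  · by_cases h3 : v 3 = 0
    · rw [eval_pderiv_two_quinticOne_of_mem v h2 h3] at hz
      rw [h2, h3] at ht
      refine hv ?_
      have h0 : v 0 = 0 := by simpa using hz
      have h1 : v 1 = 0 := by simpa using ht
      ext i; fin_cases i <;> simp [h0, h1, h2, h3]
    · obtain ⟨x, h0⟩ : ∃ x, v 0 = x * v 3 := ⟨v 0 / v 3, by field_simp⟩
      obtain ⟨y, h1⟩ : ∃ y, v 1 = y * v 3 := ⟨v 1 / v 3, by field_simp⟩
      rw [h0, h1, h2] at hF hx hy
      refine no_singular_point_of_zero (x := x) (y := y)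
        ((mul_eq_zero_iff_left (pow_ne_zero 5 h3)).1 ?_)
        ((mul_eq_zero_iff_left (pow_ne_zero 4 h3)).1 ?_)
        ((mul_eq_zero_iff_left (pow_ne_zero 4 h3)).1 ?_)
      · linear_combination hF
      · linear_combination hx
      · linear_combination hy
  · obtain ⟨x, h0⟩ : ∃ x, v 0 = x * v 2 := ⟨v 0 / v 2, by field_simp⟩
    obtain ⟨y, h1⟩ : ∃ y, v 1 = y * v 2 := ⟨v 1 / v 2, by field_simp⟩
    obtain ⟨t, h3⟩ : ∃ t, v 3 = t * v 2 := ⟨v 3 / v 2, by field_simp⟩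
    rw [h0, h1, h3] at hF hx hy ht
    refine no_singular_point_of_one (x := x) (y := y) (t := t)
      ((mul_eq_zero_iff_left (pow_ne_zero 5 h2)).1 ?_)
      ((mul_eq_zero_iff_left (pow_ne_zero 4 h2)).1 ?_)
      ((mul_eq_zero_iff_left (pow_ne_zero 4 h2)).1 ?_)
      ((mul_eq_zero_iff_left (pow_ne_zero 4 h2)).1 ?_)
    · linear_combination hF
    · linear_combination hx
    · linear_combination hy
    · linear_combination ht

end Smoothness

/-! ### The 28 lines meeting ℓ. -/

section Lines

variable {K : Type*} [Field K]

/-- The polynomial of degree `28` whose zeros `s` are the points `(s : 1 : 0 : 0)` of `ℓ` that lie on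
another line of the surface `quinticOne`. -/
noncomputable def pointPolynomial (K : Type*) [Field K] : Polynomial K :=
  Polynomial.X ^ 28 + 252 * Polynomial.X ^ 24 - 250 * Polynomial.X ^ 20 + 251 * Polynomial.X ^ 16
    - 251 * Polynomial.X ^ 12 + 250 * Polynomial.X ^ 8 - 252 * Polynomial.X ^ 4 - 1

lemma eval_pointPolynomial (s : K) : (pointPolynomial K).eval s =
    s ^ 28 + 252 * s ^ 24 - 250 * s ^ 20 + 251 * s ^ 16 - 251 * s ^ 12 + 250 * s ^ 8
      - 252 * s ^ 4 - 1 := by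
  simp [pointPolynomial]

lemma ne_zero_of_eval_pointPolynomial {s : K} (h : (pointPolynomial K).eval s = 0) : s ≠ 0 := by
  rintro rfl
  simp [eval_pointPolynomial] at h

lemma natDegree_pointPolynomial : (pointPolynomial K).natDegree = 28 := by
  rw [pointPolynomial]
  compute_degree!

lemma separable_pointPolynomial [IsAlgClosed K] [CharZero K] : (pointPolynomial K).Separable := by
  rw [Polynomial.Separable, Polynomial.isCoprime_iff_aeval_ne_zero_of_isAlgClosed K K]
  intro s
  by_contra! h
  obtain ⟨h1, h2⟩ := h
  rw [Polynomial.coe_aeval_eq_eval] at h1 h2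
  have hs := ne_zero_of_eval_pointPolynomial h1
  rw [eval_pointPolynomial] at h1
  simp [pointPolynomial] at h2
  -- The point polynomial is the septic evaluated at `-s⁴`; its derivative carries the extra factor
  -- `-4 s³`, which is nonzero.
  refine septic_squarefree (t := -s ^ 4) ?_
    ((mul_eq_zero_iff_left (mul_ne_zero (by norm_num : (4 : K) ≠ 0) (pow_ne_zero 3 hs))).1 ?_)
  · linear_combination h1
  · linear_combination -h2

lemma encard_roots_pointPolynomial [IsAlgClosed K] [CharZero K] :
    {s : K | (pointPolynomial K).eval s = 0}.encard = 28 := by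
  have h0 : pointPolynomial K ≠ 0 := by
    intro h
    have := natDegree_pointPolynomial (K := K)
    simp [h] at this
  have hc := Polynomial.card_rootSet_eq_natDegree (K := K) (separable_pointPolynomial (K := K))
    (IsAlgClosed.splits _)
  rw [natDegree_pointPolynomial] at hc
  have he : {s : K | (pointPolynomial K).eval s = 0} = (pointPolynomial K).rootSet K := by
    ext s
    simp [Polynomial.mem_rootSet, h0]
  rw [he, ← Set.coe_fintypeCard, hc]
  rfl

/-- The abscissa of the point with `x₂ = 0`, `x₃ = 1` on the only line through `(s : 1 : 0 : 0)` that
may lie on `quinticOne` besides `ℓ`. -/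
noncomputable def slope (s : K) : K := -((1 - s ^ 3) * (1 - s ^ 4)) / (4 * s)

/-- The only line through `(s : 1 : 0 : 0)` that may lie on `quinticOne` besides `ℓ`. -/
noncomputable def lineThrough (s : K) : Submodule K (Fin 4 → K) :=
  Submodule.span K {![s, 1, 0, 0], ![slope s, 0, 1, -s ^ 4]}

lemma mem_lineThrough {s : K} {v : Fin 4 → K} :
    v ∈ lineThrough s ↔ ∃ c d : K, v 0 = c * s + d * slope s ∧ v 1 = c ∧ v 2 = d ∧
      v 3 = -d * s ^ 4 := by
  rw [lineThrough, Submodule.mem_span_pair]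
  refine exists_congr fun c => exists_congr fun d => ⟨?_, ?_⟩
  · rintro rfl
    simp
  · rintro ⟨h0, h1, h2, h3⟩
    ext i; fin_cases i <;> simp [h0, h1, h2, h3]

lemma finrank_lineThrough (s : K) : Module.finrank K (lineThrough s) = 2 := by
  have : LinearIndependent K ![![s, 1, 0, 0], ![slope s, 0, 1, -s ^ 4]] := by
    rw [LinearIndependent.pair_iff]
    intro c d h
    have h1 := congrFun h 1
    have h2 := congrFun h 2
    simp at h1 h2
    exact ⟨h1, h2⟩
  have h := finrank_span_eq_card this
  rwa [Matrix.range_cons_cons_empty, Fintype.card_fin] at h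

/-- This line is a component of `t U² + W² = 0` in the plane `t = -s⁴`, so only the septic term of
the decomposition survives. -/
lemma eval_quinticOne_of_mem_lineThrough [CharZero K] {s : K} (hs : s ≠ 0) {v : Fin 4 → K}
    (hv : v ∈ lineThrough s) :
    256 * s ^ 4 * eval v (quinticOne K) = -v 2 ^ 5 * (pointPolynomial K).eval s := by
  obtain ⟨c, d, h0, h1, h2, h3⟩ := mem_lineThrough.1 hv
  rw [eval_quinticOne, h0, h1, h2, h3, eval_pointPolynomial, slope]
  field_simp
  ring

lemma isLineOn_lineThrough_iff [CharZero K] {s : K} (hs : s ≠ 0) :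
    IsLineOn (quinticOne K) (lineThrough s) ↔ (pointPolynomial K).eval s = 0 := by
  refine ⟨fun h => ?_, fun h => ⟨finrank_lineThrough s, fun v hv => ?_⟩⟩
  · have hv : ![slope s, 0, 1, -s ^ 4] ∈ lineThrough s := Submodule.subset_span (by simp)
    have := eval_quinticOne_of_mem_lineThrough hs hv
    rw [h.2 _ hv] at this
    simpa using this
  · have := eval_quinticOne_of_mem_lineThrough hs hv
    rw [h, mul_zero] at this
    exact (mul_eq_zero_iff_left (by simp [hs])).1 this

lemma mem_lineThrough_self (s : K) : ![s, 1, 0, 0] ∈ lineThrough s :=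
  Submodule.subset_span (by simp)

lemma lineThrough_injective : Function.Injective (lineThrough (K := K)) := by
  intro s r h
  have hs := mem_lineThrough_self s
  rw [h, mem_lineThrough] at hs
  obtain ⟨c, d, h0, h1, h2, -⟩ := hs
  simp at h0 h1 h2
  rw [h0, ← h1, ← h2]
  ring

lemma lineThrough_ne_lineEll (s : K) : lineThrough s ≠ lineEll K := by
  intro h
  have hv : ![slope s, 0, 1, -s ^ 4] ∈ lineThrough s := Submodule.subset_span (by simp)
  rw [h] at hv
  have := hv.1
  simp at this

lemma lineThrough_inf_lineEll (s : K) : lineThrough s ⊓ lineEll K ≠ ⊥ := by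
  intro h
  have hv : ![s, 1, 0, 0] ∈ lineThrough s ⊓ lineEll K :=
    ⟨mem_lineThrough_self s, by simp [lineEll]⟩
  rw [h, Submodule.mem_bot] at hv
  simpa using congrFun hv 1

lemma slope_eq_of_coeff [CharZero K] {s b : K} (hs : s ≠ 0)
    (h : 4 * s ^ 3 * b + s ^ 2 - s ^ 5 - s ^ 6 + s ^ 9 = 0) : b = slope s := by
  rw [slope, eq_div_iff (by simp [hs])]
  refine mul_left_cancel₀ (pow_ne_zero 2 hs) ?_
  linear_combination h

/-- Along the line the form is a quartic polynomial in `u` vanishing identically: the coefficient of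
`u⁴` fixes the plane containing the line, that of `u³` then fixes the line. -/
lemma eq_lineThrough_of_isLineOn [CharZero K] {M : Submodule K (Fin 4 → K)}
    (hM : IsLineOn (quinticOne K) M) (hne : M ≠ lineEll K) (hinf : M ⊓ lineEll K ≠ ⊥) :
    ∃ s : K, s ≠ 0 ∧ lineThrough s = M := by
  obtain ⟨P, ⟨hPM, hP2 : P 2 = 0, hP3 : P 3 = 0⟩, hP0⟩ :=
    Submodule.exists_mem_ne_zero_of_ne_bot hinf
  have hle : ¬ M ≤ lineEll K := fun h => hne
    (Submodule.eq_of_le_of_finrank_eq h (by rw [hM.1, finrank_lineEll]))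
  obtain ⟨Q, hQM, hQ⟩ := SetLike.not_le_iff_exists.1 hle
  have hQ' : ¬ (Q 2 = 0 ∧ Q 3 = 0) := hQ
  -- the form vanishes at `u P + Q` for all `u`
  have hF (u : K) : eval (u • P + Q) (quinticOne K) = 0 :=
    hM.2 _ (M.add_mem (M.smul_mem u hPM) hQM)
  simp only [eval_quinticOne, Pi.add_apply, Pi.smul_apply, smul_eq_mul, hP2, hP3, mul_zero,
    zero_add] at hF
  have h4 : Q 2 * P 0 ^ 4 + Q 3 * P 1 ^ 4 = 0 := by
    -- The fourth difference at `-2, …, 2` is 24 times the coefficient of `u⁴`.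
    linear_combination (hF 2 + hF (-2) - 4 * hF 1 - 4 * hF (-1) + 6 * hF 0) / 24
  have hP1 : P 1 ≠ 0 := by
    intro h1
    have h0 : P 0 ≠ 0 := fun h0 => hP0 (by ext i; fin_cases i <;> simp [h0, h1, hP2, hP3])
    have hQ2 : Q 2 = 0 := by simpa [h1, h0] using h4
    rw [h1, hQ2] at hF
    -- The coefficient of `u²`, as a second difference; it excludes the ramification point `P 1 =
    -- 0`.
    have : Q 3 ^ 3 * P 0 ^ 2 = 0 := by
      linear_combination 4 * (hF 1 + hF (-1) - 2 * hF 0)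
    exact hQ' ⟨hQ2, by simpa [h0] using this⟩
  have hQ2 : Q 2 ≠ 0 := fun h => hQ' ⟨h, by simpa [h, hP1] using h4⟩
  have hP0' : P 0 ≠ 0 := by
    intro h0
    have hQ3 : Q 3 = 0 := by simpa [h0, hP1] using h4
    rw [h0, hQ3] at hF
    have : Q 2 ^ 3 * P 1 ^ 2 = 0 := by
      linear_combination 4 * (hF 1 + hF (-1) - 2 * hF 0)
    exact hQ2 (by simpa [hP1] using this)
  have hs : P 0 / P 1 ≠ 0 := div_ne_zero hP0' hP1
  refine ⟨P 0 / P 1, hs, ?_⟩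
  generalize hsdef : P 0 / P 1 = s at hs
  have hv : ![s, 1, 0, 0] ∈ M := by
    convert M.smul_mem (P 1)⁻¹ hPM using 1
    ext i; fin_cases i <;> simp [hP1, hP2, hP3, ← hsdef]
    field_simp
  have ht : Q 3 / Q 2 = -s ^ 4 := by
    rw [← hsdef]
    field_simp
    linear_combination h4
  obtain ⟨b, hb⟩ : ∃ b, ![b, 0, 1, -s ^ 4] ∈ M := by
    refine ⟨Q 0 / Q 2 - Q 1 / Q 2 * s, ?_⟩
    convert M.sub_mem (M.smul_mem (Q 2)⁻¹ hQM) (M.smul_mem (Q 1 / Q 2) hv) using 1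
    ext i; fin_cases i <;> simp [hQ2, ← ht] <;> field_simp <;> ring
  have hG (u : K) := hM.2 _ (M.add_mem (M.smul_mem u hv) hb)
  simp [eval_quinticOne] at hG
  -- The odd difference isolates the coefficient of `u³`, which is linear in `b` with leading
  -- coefficient `4 s³ ≠ 0`.
  obtain rfl : b = slope s := slope_eq_of_coeff hs (by
    linear_combination (hG 2 - hG (-2) - 2 * hG 1 + 2 * hG (-1)) / 12)
  refine Submodule.eq_of_le_of_finrank_eq ?_ (by rw [finrank_lineThrough, hM.1])
  rw [lineThrough, Submodule.span_le]
  rintro v (rfl | rfl)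
  · exact hv
  · exact hb

lemma valency_quinticOne [IsAlgClosed K] [CharZero K] :
    valency (quinticOne K) (lineEll K) = 28 := by
  have h : {M : Submodule K (Fin 4 → K) | IsLineOn (quinticOne K) M ∧ M ≠ lineEll K ∧
      M ⊓ lineEll K ≠ ⊥} = lineThrough '' {s : K | (pointPolynomial K).eval s = 0} := by
    ext M
    constructor
    · rintro ⟨hM, hne, hinf⟩
      obtain ⟨s, hs, rfl⟩ := eq_lineThrough_of_isLineOn hM hne hinf
      exact ⟨s, (isLineOn_lineThrough_iff hs).1 hM, rfl⟩
    · rintro ⟨s, hs, rfl⟩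
      exact ⟨(isLineOn_lineThrough_iff (ne_zero_of_eval_pointPolynomial hs)).2 hs,
        lineThrough_ne_lineEll s, lineThrough_inf_lineEll s⟩
  rw [valency, h, lineThrough_injective.encard_image, encard_roots_pointPolynomial]

end Lines

end QuinticLines

theorem mainTheorem5 (K : Type*) [Field K] [IsAlgClosed K] [CharZero K] :
    -- the members of the family are quintics carrying a line of type (3²) with 𝔟₁ ≡ 0
    (∀ (a : Fin 4 → K) (p : Fin 6 → K),
      (QuinticLines.familyZ a p).IsHomogeneous 5 ∧ QuinticLines.familyZ a p ≠ 0 ∧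
      QuinticLines.IsLineOn (QuinticLines.familyZ a p) (QuinticLines.lineEll K) ∧
      QuinticLines.HasRamificationType (QuinticLines.familyZ a p) {3, 3} ∧
      QuinticLines.FrakBDefined (QuinticLines.familyZ a p) ∧
      QuinticLines.frakB 5 1 (QuinticLines.familyZ a p) = 0) ∧
    -- within the normal form for type (3²), the vanishing of 𝔟₁ characterizes the family
    (∀ (a : Fin 4 → K) (q : Fin 5 → Fin 2 → K) (p : Fin 6 → K),
      QuinticLines.FrakBDefined (QuinticLines.normalForm a q p) ∧
      (QuinticLines.frakB 5 1 (QuinticLines.normalForm a q p) = 0 ↔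
        QuinticLines.normalForm a q p = QuinticLines.familyZ a p)) ∧
    -- the member with all parameters 1 is smooth, and ℓ meets exactly 28 other lines on it
    (QuinticLines.IsSmoothSurface 5 (QuinticLines.familyZ (fun _ => (1 : K)) (fun _ => 1)) ∧
      QuinticLines.valency (QuinticLines.familyZ (fun _ => (1 : K)) (fun _ => 1))
        (QuinticLines.lineEll K) = 28) ∧
    -- hence no bound smaller than 28 holds for all lines on smooth quintics
    (∀ N : ℕ∞,
      (∀ (f : MvPolynomial (Fin 4) K) (L : Submodule K (Fin 4 → K)),
        QuinticLines.IsSmoothSurface 5 f → QuinticLines.IsLineOn f L →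
          QuinticLines.valency f L ≤ N) → 28 ≤ N) := by
  have hS := QuinticLines.isSmoothSurface_quinticOne (K := K)
  have hV := QuinticLines.valency_quinticOne (K := K)
  refine ⟨fun a p => ?_, fun a q p => ⟨QuinticLines.frakBDefined_normalForm a q p,
    QuinticLines.frakB_normalForm_eq_zero_iff a q p⟩, ?_, fun N hN => ?_⟩
  · have hB := QuinticLines.frakB_familyZ a p
    rw [QuinticLines.familyZ] at hB ⊢
    exact ⟨QuinticLines.isHomogeneous_normalForm a _ p, QuinticLines.normalForm_ne_zero a _ p,
      QuinticLines.isLineOn_lineEll a _ p, QuinticLines.hasRamificationType_normalForm a _ p,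
      QuinticLines.frakBDefined_normalForm a _ p, hB⟩
  · rw [QuinticLines.quinticOne] at hS hV
    exact ⟨hS, hV⟩
  · rw [← hV]
    refine hN _ _ hS ?_
    rw [QuinticLines.quinticOne, QuinticLines.familyZ]
    exact QuinticLines.isLineOn_lineEll _ _ _
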